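/- Let $-\infty<a<b<\infty$. For $n\in\mathbb{N}=\{0,1,2,\dots\}$ let $D^n$ be the ordinary derivative of order $n$ on $[a,b]$ (one-sided at the end points). For $r>0$ put $J_a^r f(x)=\frac1{\Gamma(r)}\int_a^x (x-t)^{r-1}f(t)\,dt$ for $x\in[a,b]$, and let $J_a^0$ be the identity. For $\alpha>0$, $m=\lceil\alpha\rceil$ and $f\in C^{m-1}[a,b]$ let ${}^{C}\!D_a^{\alpha}f = D^m J_a^{m-\alpha}\Big(f-\sum_{k=0}^{m-1}\frac{(D^kf)(a)}{k!}(\cdot-a)^k\Big)$, and let ${}^{C}\!D_a^{0}$ be the identity. A real function $f$ on $[a,b]$ (of class $C^{\lceil\alpha\rceil-1}[a,b]$ if $\alpha>0$) is called continuously Caputo $\alpha$-differentiable, $\alpha\ge 0$, if ${}^{C}\!D_a^{\alpha}f$ exists at every point of $[a,b]$ and is continuous on $[a,b]$. Theorem 3.6. Let $\alpha>0$ and let $f\in C^{\lceil\alpha\rceil-1}[a,b]$ be continuously Caputo $\alpha$-differentiable. Then for every integer $l$ with $0\le l\le\lceil\alpha\rceil-1$: (1) $f$ is continuously Caputo $l$-differentiable,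 with ${}^{C}\!D_a^{l}f=D^lf\in C[a,b]$; (2) $D^lf$ is continuously Caputo $(\alpha-l)$-differentiable; (3) ${}^{C}\!D_a^{\alpha-l}(D^lf)={}^{C}\!D_a^{\alpha}f$ on $[a,b]$. -/

import Mathlib

open Set

noncomputable section

namespace FracCalc

/-- The Riemann-Liouville fractional integral operator of order `r ≥ 0` with base point `a`:
the identity for `r = 0`, and
`x ↦ Γ(r)⁻¹ * ∫ t in a..x, (x - t) ^ (r - 1) * f t` for `r > 0` (used for `x ≥ a`). -/
def rlIntegral (a r : ℝ) (f : ℝ → ℝ) : ℝ → ℝ := fun x =>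
  if r = 0 then f x
  else 1 / Real.Gamma r * ∫ t in a..x, (x - t) ^ (r - 1) * f t

/-- The ordinary differential operator of order `n` on `[a, b]`
(with one-sided derivatives at the end points). -/
def classicalDeriv (a b : ℝ) (n : ℕ) (f : ℝ → ℝ) : ℝ → ℝ :=
  iteratedDerivWithin n f (Icc a b)

/-- The Riemann-Liouville derivative of order `α ≥ 0` on `[a, b]`: with `m = ⌈α⌉`, the `m`-th
derivative of the fractional integral of order `m - α`. For `α = 0` this is the identity. -/
def rlDeriv (a b α : ℝ) (f : ℝ → ℝ) : ℝ → ℝ :=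
  classicalDeriv a b ⌈α⌉₊ (rlIntegral a (⌈α⌉₊ - α) f)

/-- `f` is continuous on `[a, b]` and its Riemann-Liouville derivative of order `α ≥ 0` exists at
every point of `[a, b]` and is continuous there; i.e. with `m = ⌈α⌉` the fractional integral of
order `m - α` of `f` is of class `C^m` on `[a, b]`. -/
def ContRLDifferentiable (a b α : ℝ) (f : ℝ → ℝ) : Prop :=
  ContinuousOn f (Icc a b) ∧
    ContDiffOn ℝ (⌈α⌉₊ : ℕ) (rlIntegral a (⌈α⌉₊ - α) f) (Icc a b)

/-- `f` minus its Taylor polynomial of degree `n` centred at the left end point `a`, the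
derivatives at `a` being taken within `[a, b]`. -/
def taylorRemainder (a b : ℝ) (n : ℕ) (f : ℝ → ℝ) : ℝ → ℝ := fun t =>
  f t - ∑ k ∈ Finset.range (n + 1), classicalDeriv a b k f a / (k.factorial : ℝ) * (t - a) ^ k

/-- The Caputo derivative of order `α ≥ 0` on `[a, b]`: the identity for `α = 0`; for `α > 0` and
`m = ⌈α⌉`, the Riemann-Liouville derivative of order `α` of `f` minus its Taylor polynomial of
degree `m - 1` at `a`. -/
def caputoDeriv (a b α : ℝ) (f : ℝ → ℝ) : ℝ → ℝ :=
  if α = 0 then f else rlDeriv a b α (taylorRemainder a b (⌈α⌉₊ - 1) f)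

/-- `f` is continuously Caputo `α`-differentiable on `[a, b]` (`α ≥ 0`). For `α = 0` this means
that `f` is continuous. For `α > 0` and `m = ⌈α⌉` it means that `f` is of class `C^(m-1)` on
`[a, b]` and that its Caputo derivative of order `α` exists and is continuous on `[a, b]`. -/
def ContCaputoDifferentiable (a b α : ℝ) (f : ℝ → ℝ) : Prop :=
  (α = 0 ∧ ContinuousOn f (Icc a b)) ∨
  (0 < α ∧ ContDiffOn ℝ (⌈α⌉₊ - 1 : ℕ) f (Icc a b) ∧
    ContRLDifferentiable a b α (taylorRemainder a b (⌈α⌉₊ - 1) f))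

end FracCalc

end

namespace FracCalc

open MeasureTheory Filter Topology

/-! ### Differentiation under the fractional integral. -/

variable {a b r x : ℝ} {f g g' : ℝ → ℝ}

/-! With `m = ⌈α⌉`, the Taylor remainder of `f` of degree `m - 1` has vanishing derivatives at `a`
through order `m - 1`, so `D^l` commutes with the fractional integral on it
(`classicalDeriv_rlIntegral`). Moreover `D^l` of this remainder is the remainder of `D^l f` of
degree `m - 1 - l` (`classicalDeriv_taylorRemainder`). Since `(m - l) - (α - l) = m - α`, the Caputo
derivative of order `α - l` of `D^l f` is `D^(m-l) D^l = D^m` of the integral that defines the one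
of `f`. The analytic core is `hasDerivWithinAt_rlIntegral`: for `g a = 0`, extension by zero turns
the integral into a convolution over a fixed interval, which can be differentiated under the
integral sign. -/

theorem rlIntegral_congr (h : EqOn f g (Icc a b)) : EqOn (rlIntegral a r f) (rlIntegral a r g)
    (Icc a b) := by
  intro x hx
  simp only [rlIntegral]
  rw [h hx]
  congr 2
  refine intervalIntegral.integral_congr fun t ht => ?_
  rw [uIcc_of_le hx.1] at ht
  simp only [h ⟨ht.1, ht.2.trans hx.2⟩]

/-- The kernel integral over a variable interval as a convolution over a fixed one, for an
extension by zero to the left of the base point. -/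
theorem integral_rpow_kernel_eq {u : ℝ → ℝ} (hu : EqOn f u (Icc a b))
    (hu0 : ∀ y < a, u y = 0) (hx : x ∈ Icc a b) :
    ∫ t in a..x, (x - t) ^ (r - 1) * f t = ∫ s in 0..(b - a), s ^ (r - 1) * u (x - s) := by
  have h1 : ∫ t in a..x, (x - t) ^ (r - 1) * f t
      = ∫ t in a..x, (x - t) ^ (r - 1) * u (x - (x - t)) := by
    refine intervalIntegral.integral_congr fun t ht => ?_
    rw [uIcc_of_le hx.1] at ht
    simp only [hu ⟨ht.1, ht.2.trans hx.2⟩, sub_sub_cancel]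
  rw [h1, intervalIntegral.integral_comp_sub_left (fun s => s ^ (r - 1) * u (x - s)) x, sub_self,
    intervalIntegral.integral_of_le (sub_nonneg.2 hx.1),
    intervalIntegral.integral_of_le (by linarith [hx.1, hx.2])]
  refine (setIntegral_eq_of_subset_of_forall_sdiff_eq_zero measurableSet_Ioc
    (Ioc_subset_Ioc_right (by linarith [hx.2])) fun s hs => ?_).symm
  have : x - a < s := by
    by_contra! h
    exact hs.2 ⟨hs.1.1, h⟩
  simp [hu0 (x - s) (by linarith)]

/-- The Lipschitz constant times the integrable kernel dominates the difference quotients. A corner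
of `H` at `a` affects only `s = x - a`, a null set. -/
theorem hasDerivAt_integral_rpow_mul_of_lipschitz {c : ℝ} {K : NNReal} {H G : ℝ → ℝ} (hr : 0 < r)
    (hH : LipschitzWith K H) (hG : Measurable G) (hHG : ∀ y ≠ a, HasDerivAt H (G y) y) :
    HasDerivAt (fun x => ∫ s in 0..c, s ^ (r - 1) * H (x - s))
      (∫ s in 0..c, s ^ (r - 1) * G (x - s)) x := by
  have hk : IntervalIntegrable (fun s : ℝ => s ^ (r - 1)) volume 0 c :=
    intervalIntegral.intervalIntegrable_rpow' (by linarith)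
  refine (intervalIntegral.hasDerivAt_integral_of_dominated_loc_of_lip
    (F := fun x s => s ^ (r - 1) * H (x - s)) (bound := fun s => s ^ (r - 1) * K)
    (univ_mem (f := 𝓝 x)) ?_ ?_ ?_ ?_ (hk.mul_const _) ?_).2
  · refine Eventually.of_forall fun y => Measurable.aestronglyMeasurable ?_
    have := hH.continuous.measurable
    fun_prop
  · exact hk.mul_continuousOn
      (hH.continuous.comp (continuous_const.sub continuous_id)).continuousOn
  · refine Measurable.aestronglyMeasurable ?_
    fun_prop
  · refine Eventually.of_forall fun s _ => (LipschitzWith.of_dist_le_mul fun y z => ?_).lipschitzOnWith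
    have := hH.dist_le_mul (y - s) (z - s)
    rw [Real.dist_eq, Real.dist_eq] at *
    rw [← mul_sub, abs_mul]
    simp only [Real.coe_nnabs, abs_mul, NNReal.abs_eq, mul_assoc]
    rw [sub_sub_sub_cancel_right] at this
    gcongr
  · have : ∀ᵐ s : ℝ, s ≠ x - a := by simp [ae_iff]
    filter_upwards [this] with s hs _
    have hne : x - s ≠ a := fun h => hs (by linarith)
    exact ((hHG _ hne).comp_sub_const x s).const_mul _

/-- The fractional integral commutes with differentiation of functions vanishing at the base
point. -/
theorem hasDerivWithinAt_rlIntegral (hab : a < b) (hr : 0 ≤ r)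
    (hg : ∀ y ∈ Icc a b, HasDerivWithinAt g (g' y) (Icc a b) y) (hg' : ContinuousOn g' (Icc a b))
    (hga : g a = 0) (hx : x ∈ Icc a b) :
    HasDerivWithinAt (rlIntegral a r g) (rlIntegral a r g' x) (Icc a b) x := by
  rcases hr.eq_or_lt with rfl | hr
  · have e : ∀ u : ℝ → ℝ, rlIntegral a 0 u = u := fun u => by ext; simp [rlIntegral]
    simpa only [e] using hg x hx
  set h : ℝ → ℝ := IccExtend hab.le (domRestrict (Icc a b) g') with hh
  have hcont : Continuous h := hg'.domRestrict.Icc_extend'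
  have hEq : EqOn g' h (Icc a b) := fun y hy => by
    rw [hh, IccExtend_of_mem hab.le _ hy, domRestrict_apply]
  obtain ⟨K, hK⟩ := isCompact_Icc.exists_bound_of_continuousOn hg'
  have hK0 : 0 ≤ K := (norm_nonneg _).trans (hK a (left_mem_Icc.2 hab.le))
  have hbd : ∀ y, ‖h y‖ ≤ K := fun y => hK _ (projIcc a b hab.le y).2
  set Φ : ℝ → ℝ := fun y => ∫ t in a..y, h t with hΦ
  have hΦd : ∀ y, HasDerivAt Φ (h y) y := fun y => hcont.integral_hasStrictDerivAt a y |>.hasDerivAt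
  have hΦL : LipschitzWith K.toNNReal Φ := by
    refine lipschitzWith_of_nnnorm_deriv_le (fun y => (hΦd y).differentiableAt) fun y => ?_
    rw [(hΦd y).deriv, ← NNReal.coe_le_coe]
    simpa [hK0] using hbd y
  -- Extension of `g` by zero to the left of `a`: Lipschitz because `g a = 0`, with a possible
  -- corner at `a`.
  set H : ℝ → ℝ := fun y => Φ (max a y) with hH
  have hHL : LipschitzWith K.toNNReal H := by
    have := hΦL.comp ((LipschitzWith.id (α := ℝ)).const_max a)
    rwa [mul_one] at this
  have hH0 : ∀ y < a, H y = 0 := fun y hy => by simp [hH, hΦ, max_eq_left hy.le]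
  have hgH : EqOn g H (Icc a b) := fun y hy => by
    have hsub : Icc a y ⊆ Icc a b := Icc_subset_Icc_right hy.2
    have h1 : ∫ t in a..y, h t = g y - g a := by
      refine intervalIntegral.integral_eq_sub_of_hasDerivAt_of_le hy.1
        (fun t ht => ((hg t (hsub ht)).continuousWithinAt).mono hsub) (fun t ht => ?_)
        (hcont.intervalIntegrable _ _)
      rw [← hEq (hsub (Ioo_subset_Icc_self ht))]
      exact (hg t (hsub (Ioo_subset_Icc_self ht))).hasDerivAt
        (Icc_mem_nhds ht.1 (ht.2.trans_le hy.2))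
    simp only [hH, hΦ, max_eq_right hy.1, h1, hga, sub_zero]
  set G : ℝ → ℝ := (Ici a).indicator h with hG
  have hGm : Measurable G := hcont.measurable.indicator measurableSet_Ici
  have hHG : ∀ y ≠ a, HasDerivAt H (G y) y := by
    intro y hy
    rcases hy.lt_or_gt with hy | hy
    · rw [hG, indicator_of_notMem (by simpa using hy)]
      refine (hasDerivAt_const y (0 : ℝ)).congr_of_eventuallyEq ?_
      filter_upwards [Iio_mem_nhds hy] with z hz using hH0 z hz
    · rw [hG, indicator_of_mem (by simpa using hy.le)]
      refine (hΦd y).congr_of_eventuallyEq ?_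
      filter_upwards [Ioi_mem_nhds hy] with z hz
      simp only [hH, max_eq_right (mem_Ioi.1 hz).le]
  have hg'G : EqOn g' G (Icc a b) := fun y hy => by
    rw [hEq hy, hG, indicator_of_mem (by simpa using hy.1)]
  have hG0 : ∀ y < a, G y = 0 := fun y hy => indicator_of_notMem (by simpa using hy) _
  have key := ((hasDerivAt_integral_rpow_mul_of_lipschitz (c := b - a) (x := x) hr hHL hGm
    hHG).const_mul (1 / Real.Gamma r)).hasDerivWithinAt (s := Icc a b)
  have e : ∀ y ∈ Icc a b, rlIntegral a r g y
      = 1 / Real.Gamma r * ∫ s in 0..(b - a), s ^ (r - 1) * H (y - s) := fun y hy => by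
    simp only [rlIntegral, hr.ne', if_false, integral_rpow_kernel_eq hgH hH0 hy]
  have e' : rlIntegral a r g' x
      = 1 / Real.Gamma r * ∫ s in 0..(b - a), s ^ (r - 1) * G (x - s) := by
    simp only [rlIntegral, hr.ne', if_false, integral_rpow_kernel_eq hg'G hG0 hx]
  rw [e']
  exact key.congr e (e x hx)

/-! ### Iterated derivatives on the interval. -/

variable {n k l : ℕ}

theorem classicalDeriv_succ : classicalDeriv a b (n + 1) f =
    derivWithin (classicalDeriv a b n f) (Icc a b) := iteratedDerivWithin_succ

theorem classicalDeriv_congr (h : EqOn f g (Icc a b)) :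
    EqOn (classicalDeriv a b n f) (classicalDeriv a b n g) (Icc a b) :=
  iteratedDerivWithin_congr h

theorem classicalDeriv_add :
    classicalDeriv a b (n + k) f = classicalDeriv a b n (classicalDeriv a b k f) := by
  induction n with
  | zero => simp [classicalDeriv]
  | succ n ih => rw [add_right_comm, classicalDeriv_succ, ih, classicalDeriv_succ]

theorem contDiffOn_classicalDeriv (hab : a < b) (hf : ContDiffOn ℝ (n + k : ℕ) f (Icc a b)) :
    ContDiffOn ℝ n (classicalDeriv a b k f) (Icc a b) := by
  induction k generalizing n with
  | zero => simpa [classicalDeriv] using hf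
  | succ k ih =>
    rw [classicalDeriv_succ]
    refine (ih (n := n + 1) ?_).derivWithin (uniqueDiffOn_Icc hab) (by norm_cast)
    rwa [add_right_comm]

theorem hasDerivWithinAt_classicalDeriv (hab : a < b) (hf : ContDiffOn ℝ n f (Icc a b))
    (hk : k < n) (hx : x ∈ Icc a b) :
    HasDerivWithinAt (classicalDeriv a b k f) (classicalDeriv a b (k + 1) f x) (Icc a b) x := by
  rw [classicalDeriv_succ]
  exact ((hf.differentiableOn_iteratedDerivWithin (by exact_mod_cast hk)
    (uniqueDiffOn_Icc hab)) x hx).hasDerivWithinAt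

theorem continuousOn_classicalDeriv (hab : a < b) (hf : ContDiffOn ℝ n f (Icc a b))
    (hk : k ≤ n) : ContinuousOn (classicalDeriv a b k f) (Icc a b) :=
  hf.continuousOn_iteratedDerivWithin (by exact_mod_cast hk) (uniqueDiffOn_Icc hab)

theorem classicalDeriv_rlIntegral (hab : a < b) (hr : 0 ≤ r) (hg : ContDiffOn ℝ n g (Icc a b))
    (hga : ∀ k < n, classicalDeriv a b k g a = 0) (hl : l ≤ n) :
    EqOn (classicalDeriv a b l (rlIntegral a r g)) (rlIntegral a r (classicalDeriv a b l g))
      (Icc a b) := by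
  induction l with
  | zero => intro x _; simp [classicalDeriv]
  | succ l ih =>
    intro x hx
    rw [classicalDeriv_succ, derivWithin_congr (ih (by omega)) (ih (by omega) hx)]
    exact (hasDerivWithinAt_rlIntegral hab hr
      (fun y hy => hasDerivWithinAt_classicalDeriv hab hg hl hy)
      (continuousOn_classicalDeriv hab hg hl) (hga l hl) hx).derivWithin
      (uniqueDiffOn_Icc hab x hx)

/-! ### Taylor remainders. -/

theorem taylorRemainder_left : taylorRemainder a b n f a = 0 := by
  simp [taylorRemainder, Finset.sum_range_succ', classicalDeriv]

theorem contDiffOn_taylorRemainder {m : WithTop ℕ∞} (hf : ContDiffOn ℝ m f (Icc a b)) :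
    ContDiffOn ℝ m (taylorRemainder a b n f) (Icc a b) := by
  refine hf.sub (ContDiff.contDiffOn ?_)
  fun_prop

theorem hasDerivWithinAt_taylorRemainder
    (hf : DifferentiableWithinAt ℝ f (Icc a b) x) :
    HasDerivWithinAt (taylorRemainder a b (n + 1) f)
      (taylorRemainder a b n (derivWithin f (Icc a b)) x) (Icc a b) x := by
  have hs : HasDerivAt (fun t => ∑ k ∈ Finset.range (n + 2),
      classicalDeriv a b k f a / (k.factorial : ℝ) * (t - a) ^ k)
      (∑ k ∈ Finset.range (n + 1),
        classicalDeriv a b k (derivWithin f (Icc a b)) a / (k.factorial : ℝ) * (x - a) ^ k) x := by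
    have h : ∀ k ∈ Finset.range (n + 2), HasDerivAt
        (fun t => classicalDeriv a b k f a / (k.factorial : ℝ) * (t - a) ^ k)
        (classicalDeriv a b k f a / (k.factorial : ℝ) * (k * (x - a) ^ (k - 1))) x := fun k _ => by
      simpa using ((((hasDerivAt_id x).sub_const a).pow k).const_mul
        (classicalDeriv a b k f a / (k.factorial : ℝ)))
    refine (HasDerivAt.fun_sum h).congr_deriv ?_
    -- The constant term drops out; in the others the factor `k + 1` cancels against the factorial.
    rw [Finset.sum_range_succ' _ (n + 1)]
    simp only [Nat.cast_zero, zero_mul, mul_zero, add_zero, Nat.add_sub_cancel]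
    refine Finset.sum_congr rfl fun k _ => ?_
    rw [classicalDeriv_add (n := k) (k := 1), Nat.factorial_succ]
    have : classicalDeriv a b 1 f = derivWithin f (Icc a b) := by
      rw [← zero_add 1, classicalDeriv_succ, classicalDeriv, iteratedDerivWithin_zero]
    rw [this]
    push_cast
    field_simp
  exact hf.hasDerivWithinAt.sub hs.hasDerivWithinAt

theorem classicalDeriv_taylorRemainder (hab : a < b) (hf : ContDiffOn ℝ l f (Icc a b)) :
    EqOn (classicalDeriv a b l (taylorRemainder a b (n + l) f))
      (taylorRemainder a b n (classicalDeriv a b l f)) (Icc a b) := by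
  induction l generalizing n with
  | zero => intro x _; simp [classicalDeriv]
  | succ l ih =>
    have ih' := ih (n := n + 1) (hf.of_le (by norm_cast; omega))
    rw [add_right_comm] at ih'
    intro x hx
    rw [classicalDeriv_succ, ← add_assoc, derivWithin_congr ih' (ih' hx), classicalDeriv_succ]
    exact (hasDerivWithinAt_taylorRemainder
      (hasDerivWithinAt_classicalDeriv hab hf l.lt_succ_self hx).differentiableWithinAt).derivWithin
      (uniqueDiffOn_Icc hab x hx)

/-- The `n`-th derivatives differ by a constant, which `derivWithin` ignores even where the function
is not differentiable; class `C^n` therefore suffices. -/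
theorem classicalDeriv_succ_taylorRemainder (hab : a < b) (hf : ContDiffOn ℝ n f (Icc a b)) :
    EqOn (classicalDeriv a b (n + 1) (taylorRemainder a b n f)) (classicalDeriv a b (n + 1) f)
      (Icc a b) := by
  have h := classicalDeriv_taylorRemainder (n := 0) hab hf
  rw [zero_add] at h
  intro x hx
  have e : taylorRemainder a b 0 (classicalDeriv a b n f) =
      fun t => classicalDeriv a b n f t - classicalDeriv a b n f a := by
    ext
    simp [taylorRemainder, classicalDeriv]
  rw [classicalDeriv_succ, derivWithin_congr h (h hx), classicalDeriv_succ, e,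
    derivWithin_sub_const]

theorem classicalDeriv_taylorRemainder_left (hab : a < b) (hf : ContDiffOn ℝ n f (Icc a b))
    (hk : k ≤ n) : classicalDeriv a b k (taylorRemainder a b n f) a = 0 := by
  obtain ⟨j, rfl⟩ := Nat.exists_eq_add_of_le' hk
  rw [classicalDeriv_taylorRemainder hab (hf.of_le (by norm_cast)) (left_mem_Icc.2 hab.le),
    taylorRemainder_left]

/-! ### Integer orders and the main theorem. -/

theorem contCaputoDifferentiable_natCast (hf : ContDiffOn ℝ n f (Icc a b)) :
    ContCaputoDifferentiable a b n f := by
  rcases n.eq_zero_or_pos with rfl | hn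
  · exact Or.inl ⟨Nat.cast_zero, hf.continuousOn⟩
  · refine Or.inr ⟨by exact_mod_cast hn, ?_, ?_, ?_⟩
    · rw [Nat.ceil_natCast]
      exact hf.of_le (by norm_cast; omega)
    · exact (contDiffOn_taylorRemainder hf).continuousOn
    · rw [Nat.ceil_natCast]
      refine (contDiffOn_taylorRemainder (n := n - 1) hf).congr fun x _ => ?_
      simp [rlIntegral]

theorem caputoDeriv_natCast (hab : a < b) (hf : ContDiffOn ℝ n f (Icc a b)) :
    EqOn (caputoDeriv a b n f) (classicalDeriv a b n f) (Icc a b) := by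
  cases n with
  | zero => intro x _; simp [caputoDeriv, classicalDeriv]
  | succ n =>
    have e : ∀ u : ℝ → ℝ, rlIntegral a 0 u = u := fun u => by ext; simp [rlIntegral]
    intro x hx
    rw [caputoDeriv, if_neg (by positivity), rlDeriv, Nat.ceil_natCast, sub_self, e,
      Nat.add_sub_cancel]
    exact classicalDeriv_succ_taylorRemainder hab (hf.of_le (by norm_cast; omega)) hx

end FracCalc

open FracCalc in
theorem theorem3p6 (a b : ℝ) (hab : a < b) (α : ℝ) (hα : 0 < α) (f : ℝ → ℝ)
    (hf : ContDiffOn ℝ (⌈α⌉₊ - 1 : ℕ) f (Set.Icc a b))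
    (hfα : FracCalc.ContCaputoDifferentiable a b α f)
    (l : ℕ) (hl : l ≤ ⌈α⌉₊ - 1) :
    FracCalc.ContCaputoDifferentiable a b (l : ℝ) f ∧
    Set.EqOn (FracCalc.caputoDeriv a b (l : ℝ) f) (FracCalc.classicalDeriv a b l f)
      (Set.Icc a b) ∧
    ContinuousOn (FracCalc.classicalDeriv a b l f) (Set.Icc a b) ∧
    FracCalc.ContCaputoDifferentiable a b (α - l) (FracCalc.classicalDeriv a b l f) ∧
    Set.EqOn (FracCalc.caputoDeriv a b (α - l) (FracCalc.classicalDeriv a b l f))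
      (FracCalc.caputoDeriv a b α f) (Set.Icc a b) := by
  have hl' : ContDiffOn ℝ l f (Icc a b) := hf.of_le (by exact_mod_cast hl)
  -- `p` is the degree of the Taylor polynomial belonging to `D^l f` and order `α - l`.
  obtain ⟨p, hp⟩ : ∃ p, ⌈α⌉₊ = p + l + 1 :=
    ⟨⌈α⌉₊ - 1 - l, by have := Nat.ceil_pos.2 hα; omega⟩
  have hαl : 0 < α - l := by
    have : ((p + l : ℕ) : ℝ) < α := Nat.lt_ceil.1 (by omega)
    push_cast at this
    linarith [p.cast_nonneg (α := ℝ)]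
  have hceil : ⌈α - l⌉₊ = p + 1 := by rw [Nat.ceil_sub_natCast, hp]; omega
  -- Both Caputo derivatives use a fractional integral of the same order.
  have hr : ((p + 1 : ℕ) : ℝ) - (α - l) = ((p + l + 1 : ℕ) : ℝ) - α := by push_cast; ring
  have hr0 : 0 ≤ ((p + l + 1 : ℕ) : ℝ) - α := by rw [← hp]; linarith [Nat.le_ceil α]
  have hfα' : ContDiffOn ℝ (p + l + 1 : ℕ)
      (rlIntegral a ((p + l + 1 : ℕ) - α) (taylorRemainder a b (p + l) f)) (Icc a b) := by
    rcases hfα with h | ⟨-, -, -, h⟩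
    · exact absurd h.1 hα.ne'
    · simpa only [hp, Nat.add_sub_cancel] using h
  rw [hp, Nat.add_sub_cancel] at hf
  have hcomm : EqOn
      (classicalDeriv a b l (rlIntegral a ((p + l + 1 : ℕ) - α) (taylorRemainder a b (p + l) f)))
      (rlIntegral a ((p + l + 1 : ℕ) - α) (taylorRemainder a b p (classicalDeriv a b l f)))
      (Icc a b) :=
    (classicalDeriv_rlIntegral hab hr0 (contDiffOn_taylorRemainder hf)
      (fun k hk => classicalDeriv_taylorRemainder_left hab hf hk.le) (Nat.le_add_left l p)).trans
      (rlIntegral_congr (classicalDeriv_taylorRemainder hab hl'))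
  have hDl : ContDiffOn ℝ p (classicalDeriv a b l f) (Icc a b) := contDiffOn_classicalDeriv hab hf
  refine ⟨contCaputoDifferentiable_natCast hl', caputoDeriv_natCast hab hl',
    hDl.continuousOn, Or.inr ⟨hαl, ?_, ?_, ?_⟩, fun x hx => ?_⟩
  · rwa [hceil, Nat.add_sub_cancel]
  · rw [hceil, Nat.add_sub_cancel]
    exact (contDiffOn_taylorRemainder hDl).continuousOn
  · rw [hceil, Nat.add_sub_cancel, hr]
    refine (contDiffOn_classicalDeriv hab (k := l) ?_).congr hcomm.symm
    rwa [add_right_comm]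
  · rw [caputoDeriv, if_neg hαl.ne', caputoDeriv, if_neg hα.ne', rlDeriv, rlDeriv, hceil, hp,
      Nat.add_sub_cancel, Nat.add_sub_cancel, hr, ← classicalDeriv_congr hcomm hx,
      ← classicalDeriv_add, add_right_comm]
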